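/- Let $L$ be a first-order language and let $\mathcal U$ be a saturated $L$-structure whose cardinality $\kappa$ is an uncountable (strongly) inaccessible cardinal larger than $|L|$. Let $A\subseteq\mathcal U$ have cardinality $<\kappa$, let $n<\omega$, and let $\mathcal D\subseteq\mathcal U^{n}$ be arbitrary. Definitions. $\mathrm{Aut}(\mathcal U/A)$ is the group of automorphisms of $\mathcal U$ fixing $A$ pointwise; for a finite tuple $b$ and a set $\mathcal C$ of finite tuples, $o(b/A)=\{f(b): f\in\mathrm{Aut}(\mathcal U/A)\}$ and $o(\mathcal C/A)=\{f[\mathcal C]: f\in\mathrm{Aut}(\mathcal U/A)\}$. The set $\mathcal C$ is invariant over $A$ if $o(\mathcal C/A)=\{\mathcal C\}$, and Lascar invariant over $A$ if it is invariant over every elementary substructure $M\preceq\mathcal U$ with $A\subseteq M$ and $|M|<\kappa$. For $\mathcal C\subseteq\mathcal U^m$, $\langle\mathcal U,\mathcal C\rangle$ is the expansion of $\mathcal U$ by an $m$-ary predicate interpreted as $\mathcal C$, and $e(\mathcal C)$ is the collection of all $\mathcal C'\subseteq\mathcal U^m$ such that $\langle\mathcal U,\mathcal C'\rangle\equiv\langle\mathcal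 U,\mathcal C\rangle$. A family $u$ of subsets of $\mathcal U^m$ locally covers $\mathcal B\subseteq\mathcal U^m$ if for every $\mathcal K\subseteq\mathcal B$ of cardinality $\kappa$ and every $k<\omega$ there is $\mathcal C\in u$ with $k\le|\mathcal K\cap\mathcal C|$. The set $\mathcal C\subseteq\mathcal U^m$ is pseudo-invariant over $A$ if $e(\mathcal C)$ locally covers $o(b/A)$ for every $b\in\mathcal C$. Finally, $L(A;\mathcal D)$ is the set of first-order formulas, with parameters in $A$, in the language of $\langle\mathcal U,\mathcal D\rangle$. Proposition. If $\mathcal D$ is Lascar invariant over $A$, then for every $m<\omega$ and every formula $\varphi(w)\in L(A;\mathcal D)$ with $|w|=m$, the set $\varphi(\mathcal U)\subseteq\mathcal U^m$ is pseudo-invariant over $A$. -/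

import Mathlib

open FirstOrder Cardinal

universe u v w

namespace LascarPseudo

/-- A single relation symbol, of arity `n`. -/
inductive PredRel (n : ℕ) : ℕ → Type
  | mem : PredRel n n

/-- The language whose only symbol is one `n`-ary predicate. -/
def predLang (n : ℕ) : FirstOrder.Language.{0, 0} := ⟨fun _ => Empty, PredRel n⟩

/-- The language `L` together with a new `n`-ary predicate. -/
abbrev expLang (L : FirstOrder.Language.{u, v}) (n : ℕ) : FirstOrder.Language.{u, v} := L.sum (predLang n)

variable {L : FirstOrder.Language.{u, v}} {U : Type w} [L.Structure U]

/-- The interpretation of the new predicate as the set `D`. -/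
@[reducible] def predStructure {n : ℕ} (D : Set (Fin n → U)) : (predLang n).Structure U where
  funMap := fun f _ => Empty.elim f
  RelMap := fun r => match r with
    | PredRel.mem => fun x => x ∈ D

/-- The set `φ(U)` defined by the formula `φ(w) ∈ L(A; D)`, that is, by a formula with parameters
in `A` over the expansion `⟨U, D⟩`. -/
def solutionSet {n m : ℕ} {A : Set U} (D : Set (Fin n → U))
    (φ : (expLang L n)[[A]].Formula (Fin m)) : Set (Fin m → U) :=
  letI : (predLang n).Structure U := predStructure D
  {x | φ.Realize x}

/-- Truth in the expansion `⟨U, D⟩` of a sentence of the expanded language. -/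
def HoldsIn {n : ℕ} (D : Set (Fin n → U)) (φ : (expLang L n).Sentence) : Prop :=
  letI : (predLang n).Structure U := predStructure D
  U ⊨ φ

variable (L)

/-- `e(D)`: the sets `C` such that `⟨U, C⟩` and `⟨U, D⟩` are elementarily equivalent. -/
def eqClass {n : ℕ} (D : Set (Fin n → U)) : Set (Set (Fin n → U)) :=
  {C | ∀ φ : (expLang L n).Sentence, HoldsIn C φ ↔ HoldsIn D φ}

/-- `Aut(U/A)`: the automorphisms of `U` that fix `A` pointwise. -/
def autOver (A : Set U) : Set (U ≃[L] U) := {f | ∀ a ∈ A, f a = a}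

/-- `o(b/A)`: the orbit of the tuple `b` under `Aut(U/A)`. -/
def tupleOrbit {n : ℕ} (A : Set U) (b : Fin n → U) : Set (Fin n → U) :=
  {c | ∃ f ∈ autOver L A, c = f ∘ b}

/-- `o(D/A)`: the orbit of the set `D` under `Aut(U/A)`. -/
def setOrbit {n : ℕ} (A : Set U) (D : Set (Fin n → U)) : Set (Set (Fin n → U)) :=
  {C | ∃ f ∈ autOver L A, C = (fun x => f ∘ x) '' D}

/-- `D` is invariant over `A`. -/
def IsInvariant {n : ℕ} (A : Set U) (D : Set (Fin n → U)) : Prop :=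
  setOrbit L A D = {D}

/-- `D` is Lascar invariant over `A`: invariant over every (small) model containing `A`. -/
def IsLascarInvariant {n : ℕ} (A : Set U) (D : Set (Fin n → U)) : Prop :=
  ∀ M : L.ElementarySubstructure U, A ⊆ (M : Set U) → #M < #U → IsInvariant L (M : Set U) D

/-- `u` locally covers `B`: every `K ⊆ B` of the cardinality of `U` meets, for each `k`,
some member of `u` in at least `k` points. -/
def LocallyCovers {n : ℕ} (u : Set (Set (Fin n → U))) (B : Set (Fin n → U)) : Prop :=
  ∀ K ⊆ B, #K = #U → ∀ k : ℕ, ∃ C ∈ u, (k : ℕ∞) ≤ (K ∩ C).encard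

/-- `D` is pseudo-invariant over `A`. -/
def IsPseudoInvariant {n : ℕ} (A : Set U) (D : Set (Fin n → U)) : Prop :=
  ∀ b ∈ D, LocallyCovers (eqClass L D) (tupleOrbit L A b)

variable (U)

/-- `U` is a saturated `L`-structure: every finitely satisfiable set of formulas in one variable
with parameters in a set of cardinality less than that of `U` is realized in `U`. -/
def IsSaturatedModel : Prop :=
  ∀ A : Set U, #A < #U → ∀ p : Set (L[[A]].Formula (Fin 1)),
    (∀ s : Finset (L[[A]].Formula (Fin 1)), (s : Set (L[[A]].Formula (Fin 1))) ⊆ p →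
      ∃ x : Fin 1 → U, ∀ φ ∈ s, φ.Realize x) →
    ∃ x : Fin 1 → U, ∀ φ ∈ p, φ.Realize x

end LascarPseudo

universe u'
namespace LascarPseudo
open FirstOrder.Language

variable {L : FirstOrder.Language.{u, v}} {U : Type w} [L.Structure U]

/-! Fix a small model `M ⊇ A`. There are fewer than `κ` types over `M`, so `K` has an infinite
subset `T` of tuples of one type over `M` (`exists_infinite_sameType_subset`). Pick `f ∈ Aut(U/A)`
with `f b ∈ T`; the witness is `C = f[φ(U)]`, which lies in `e(φ(U))` because `f` is an isomorphism
of the expansions. It contains `T`: for `x ∈ T`, homogeneity (`SameType.exists_automorphism`) gives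
`g ∈ Aut(U/M)` taking `f b` to `x`. The conjugate `f⁻¹gf` fixes the model `f⁻¹[M] ⊇ A`, so it
preserves `D` by Lascar invariance, and hence `φ(U)`. As it sends `b` to `f⁻¹ x`, we get `x ∈ C`. -/

/-! ### Types and one-point extensions -/

/-- The families `a` and `b` have the same type: they satisfy the same formulas. -/
def SameType (L : FirstOrder.Language.{u, v}) {U : Type w} [L.Structure U] {ι : Type u'}
    (a b : ι → U) : Prop :=
  ∀ φ : L.Formula ι, φ.Realize a ↔ φ.Realize b

theorem SameType.symm {ι : Type u'} {a b : ι → U} (h : SameType L a b) : SameType L b a :=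
  fun φ => (h φ).symm

theorem SameType.comp {ι : Type u'} {κ : Type*} {a b : ι → U} (h : SameType L a b) (g : κ → ι) :
    SameType L (a ∘ g) (b ∘ g) := fun φ => by
  simpa using h (φ.relabel g)

theorem SameType.eq_iff {ι : Type u'} {a b : ι → U} (h : SameType L a b) (i j : ι) :
    a i = a j ↔ b i = b j := by
  simpa using h (Term.equal (Term.var i) (Term.var j))

/-- Two families have the same type as soon as all their finite subfamilies do. -/
theorem sameType_of_finset {ι : Type u'} {a b : ι → U}
    (h : ∀ s : Finset ι, SameType L (fun i : s => a i) (fun i : s => b i)) : SameType L a b := by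
  classical
  intro φ
  have := h φ.freeVarFinset (BoundedFormula.restrictFreeVar φ id)
  unfold Formula.Realize at this
  exact (BoundedFormula.realize_restrictFreeVar (f := id) a fun _ => rfl).symm.trans
    (this.trans (BoundedFormula.realize_restrictFreeVar (f := id) b fun _ => rfl))

/-- Families of the same type whose members exhaust `U` are matched by an automorphism. -/
theorem SameType.exists_equiv {ι : Type u'} {a b : ι → U} (h : SameType L a b)
    (ha : Function.Surjective a) (hb : Function.Surjective b) :
    ∃ e : U ≃[L] U, ∀ i, e (a i) = b i := by
  choose s hs using ha
  choose t ht using hb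
  have key : ∀ i, b (s (a i)) = b i := fun i => (h.eq_iff _ _).1 (hs _)
  have key' : ∀ i, a (t (b i)) = a i := fun i => (h.eq_iff _ _).2 (ht _)
  refine ⟨⟨⟨fun x => b (s x), fun y => a (t y), fun x => ?_, fun y => ?_⟩, ?_, ?_⟩, key⟩
  · exact (key' _).trans (hs x)
  · exact (key _).trans (ht y)
  · intro n f x
    have := h (Term.equal (Term.func f fun k => Term.var (s (x k)))
      (Term.var (s (Structure.funMap f x))))
    simp only [Formula.realize_equal, Term.realize_func, Term.realize_var, hs, true_iff] at this
    exact this.symm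
  · intro n r x
    have := h (r.formula fun k => Term.var (s (x k)))
    simp only [Formula.realize_rel, Term.realize_var, hs] at this
    exact this.symm

/-- In a saturated structure, the type of a small family can be extended by one element. -/
theorem SameType.exists_extend (hsat : IsSaturatedModel L U) {ι : Type u'} {a b : ι → U}
    (h : SameType L a b) (hb : #(Set.range b) < #U) (x : U) :
    ∃ y : U, SameType L (Sum.elim a fun _ : Fin 1 => x) (Sum.elim b fun _ : Fin 1 => y) := by
  classical
  let toConst : L.Formula (ι ⊕ Fin 1) → L[[Set.range b]].Formula (Fin 1) := fun φ =>
    BoundedFormula.constantsVarsEquiv.symm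
      (φ.relabel (Sum.map (fun i => (⟨b i, i, rfl⟩ : Set.range b)) id))
  have htoConst : ∀ φ (z : Fin 1 → U), (toConst φ).Realize z ↔ φ.Realize (Sum.elim b z) := by
    intro φ z
    have := BoundedFormula.realize_constantsVarsEquiv (φ := toConst φ) (M := U) (v := z)
      (xs := default)
    rw [Formula.Realize, ← this, Equiv.apply_symm_apply]
    change Formula.Realize _ _ ↔ _
    rw [Formula.realize_relabel, Sum.elim_comp_map]
    rfl
  obtain ⟨z, hz⟩ := hsat (Set.range b) hb
    (toConst '' {φ | φ.Realize (Sum.elim a fun _ => x)}) (by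
      intro s hs
      obtain ⟨t, ht, rfl⟩ := Finset.subset_set_image_iff.1 hs
      -- Finite satisfiability: the existential closure of a finite conjunction belongs to the type
      -- of `a`, hence to that of `b`.
      have h1 : (Formula.iExs (Fin 1) (Formula.iInf fun φ : t => φ.1)).Realize a := by
        rw [Formula.realize_iExs]
        refine ⟨fun _ => x, ?_⟩
        rw [Formula.realize_iInf]
        exact fun φ => ht φ.2
      rw [h, Formula.realize_iExs] at h1
      obtain ⟨z, hz⟩ := h1
      rw [Formula.realize_iInf] at hz
      refine ⟨z, fun φ hφ => ?_⟩
      obtain ⟨ψ, hψ, rfl⟩ := Finset.mem_image.1 hφ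
      exact (htoConst ψ z).2 (hz ⟨ψ, hψ⟩))
  have hz' : (fun _ : Fin 1 => z 0) = z := funext fun i => by rw [Subsingleton.elim i 0]
  refine ⟨z 0, fun φ => ⟨fun hφ => ?_, fun hφ => ?_⟩⟩
  · rw [hz', ← htoConst]
    exact hz _ ⟨φ, hφ, rfl⟩
  · by_contra hn
    rw [← Formula.realize_not] at hn
    have := (htoConst _ z).1 (hz _ ⟨φ.not, hn, rfl⟩)
    rw [hz'] at hφ
    exact Formula.realize_not.1 this hφ

/-! ### Back and forth, strong homogeneity -/

/-- A set of pairs is a partial elementary map if its two projections have the same type. -/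
def IsPartialElementary (L : FirstOrder.Language.{u, v}) {U : Type w} [L.Structure U]
    (F : Set (U × U)) : Prop :=
  SameType L (fun p : F => p.1.1) (fun p : F => p.1.2)

theorem IsPartialElementary.mono {F G : Set (U × U)} (h : IsPartialElementary L G) (hFG : F ⊆ G) :
    IsPartialElementary L F :=
  SameType.comp h (Set.inclusion hFG)

theorem SameType.isPartialElementary_range {ι : Type u'} {a b : ι → U} (h : SameType L a b) :
    IsPartialElementary L (Set.range fun i => (a i, b i)) := by
  choose g hg using fun p : Set.range fun i => (a i, b i) => p.2
  have ha : a ∘ g = fun p => p.1.1 := funext fun p => congrArg Prod.fst (hg p)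
  have hb : b ∘ g = fun p => p.1.2 := funext fun p => congrArg Prod.snd (hg p)
  have := h.comp g
  rwa [ha, hb] at this

theorem isPartialElementary_of_finset {F : Set (U × U)}
    (h : ∀ s : Finset (U × U), (s : Set (U × U)) ⊆ F → IsPartialElementary L (s : Set (U × U))) :
    IsPartialElementary L F := by
  classical
  refine sameType_of_finset fun s => ?_
  have h1 := h (s.image Subtype.val) (by intro p; simp; tauto)
  exact SameType.comp h1 (fun i : s => ⟨i.1.1, by simp⟩)

theorem IsPartialElementary.exists_forth (hsat : IsSaturatedModel L U) {F : Set (U × U)}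
    (h : IsPartialElementary L F) (hF : #F < #U) (x : U) :
    ∃ y, IsPartialElementary L (insert (x, y) F) := by
  obtain ⟨y, hy⟩ := SameType.exists_extend hsat h
    ((mk_le_of_surjective (f := Set.rangeFactorization fun p : F => p.1.2)
      Set.rangeFactorization_surjective).trans_lt hF) x
  refine ⟨y, hy.isPartialElementary_range.mono ?_⟩
  rintro p (rfl | hp)
  · exact ⟨Sum.inr 0, rfl⟩
  · exact ⟨Sum.inl ⟨p, hp⟩, rfl⟩

theorem IsPartialElementary.swap {F : Set (U × U)} (h : IsPartialElementary L F) :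
    IsPartialElementary L (Prod.swap '' F) := by
  refine (SameType.isPartialElementary_range (SameType.symm h)).mono ?_
  rintro _ ⟨p, hp, rfl⟩
  exact ⟨⟨p, hp⟩, rfl⟩

theorem IsPartialElementary.exists_back (hsat : IsSaturatedModel L U) {F : Set (U × U)}
    (h : IsPartialElementary L F) (hF : #F < #U) (y : U) :
    ∃ x, IsPartialElementary L (insert (x, y) F) := by
  obtain ⟨x, hx⟩ := h.swap.exists_forth hsat (mk_image_le.trans_lt hF) y
  refine ⟨x, hx.swap.mono ?_⟩
  rw [Set.image_insert_eq, ← Set.image_comp]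
  simp

theorem IsPartialElementary.exists_back_and_forth (hsat : IsSaturatedModel L U)
    (hU : ℵ₀ ≤ #U) {F : Set (U × U)} (h : IsPartialElementary L F) (hF : #F < #U) (x : U) :
    ∃ q : U × U, IsPartialElementary L (insert (q.1, x) (insert (x, q.2) F)) := by
  obtain ⟨y, hy⟩ := h.exists_forth hsat hF x
  obtain ⟨z, hz⟩ := hy.exists_back hsat
    (mk_insert_le.trans_lt (add_lt_of_lt hU hF (one_lt_aleph0.trans_le hU))) x
  exact ⟨(z, y), hz⟩

/-- A small partial elementary map of a saturated structure extends to one that is total and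
surjective. -/
theorem IsPartialElementary.exists_total (hsat : IsSaturatedModel L U) (hU : ℵ₀ ≤ #U)
    {F : Set (U × U)} (h : IsPartialElementary L F) (hF : #F < #U) :
    ∃ G, F ⊆ G ∧ IsPartialElementary L G ∧ (∀ x, ∃ y, (x, y) ∈ G) ∧ ∀ y, ∃ x, (x, y) ∈ G := by
  classical
  -- The order type is the initial ordinal of `#U`, so proper initial segments, and hence all
  -- stages, stay small.
  obtain ⟨r, wo, hr⟩ := exists_ord_eq U
  -- The hypotheses on `H` sit under the existential so that `q` is total and the recursion can be
  -- defined before its stages are known to be elementary.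
  have step : ∀ (H : Set (U × U)) (x : U), ∃ q : U × U, IsPartialElementary L H → #H < #U →
      IsPartialElementary L (insert (q.1, x) (insert (x, q.2) H)) := by
    intro H x
    by_cases hH : IsPartialElementary L H ∧ #H < #U
    · obtain ⟨q, hq⟩ := hH.1.exists_back_and_forth hsat hU hH.2 x
      exact ⟨q, fun _ _ => hq⟩
    · exact ⟨(x, x), fun h1 h2 => (hH ⟨h1, h2⟩).elim⟩
  choose q hq using step
  -- `p x` is a pair: a preimage of `x`, then an image of `x`.
  let p : U → U × U := wo.wf.fix fun x ih =>
    q (F ∪ {e | ∃ y, ∃ hy : r y x, e = ((ih y hy).1, y) ∨ e = (y, (ih y hy).2)}) x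
  let stage : U → Set (U × U) := fun x => F ∪ {e | ∃ y, r y x ∧ (e = ((p y).1, y) ∨ e = (y, (p y).2))}
  have hp : ∀ x, p x = q (stage x) x := by
    intro x
    simp only [p]
    rw [WellFounded.fix_eq]
    simp only [stage, p, exists_prop]
  have hcard : ∀ x, #(stage x) < #U := by
    intro x
    have h1 : #{y // r y x} < #U := card_typein_lt x hr
    have h2 : stage x ⊆ F ∪ (Set.range (fun y : {y // r y x} => ((p y).1, y.1)) ∪
        Set.range (fun y : {y // r y x} => (y.1, (p y).2))) := by
      rintro e (he | ⟨y, hy, rfl | rfl⟩)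
      · exact Or.inl he
      · exact Or.inr (Or.inl ⟨⟨y, hy⟩, rfl⟩)
      · exact Or.inr (Or.inr ⟨⟨y, hy⟩, rfl⟩)
    refine (mk_le_mk_of_subset h2).trans_lt ((mk_union_le _ _).trans_lt (add_lt_of_lt hU hF
      ((mk_union_le _ _).trans_lt (add_lt_of_lt hU ?_ ?_))))
    · exact mk_range_le.trans_lt h1
    · exact mk_range_le.trans_lt h1
  let next : U → Set (U × U) := fun x => insert ((p x).1, x) (insert (x, (p x).2) (stage x))
  have hmono : ∀ x y, r x y → next x ⊆ stage y := by
    rintro x y hxy e (rfl | rfl | he | ⟨z, hz, he⟩)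
    · exact Or.inr ⟨x, hxy, Or.inl rfl⟩
    · exact Or.inr ⟨x, hxy, Or.inr rfl⟩
    · exact Or.inl he
    · exact Or.inr ⟨z, _root_.trans hz hxy, he⟩
  have hstage : ∀ x, stage x ⊆ next x := fun x e he => Or.inr (Or.inr he)
  -- Finite character: the sets `next x` form a chain, so a finite part of `G` lies in one of them,
  -- or in `F` when no `x` is needed.
  have hfin : ∀ (P : U → Prop) (G : Set (U × U)), (∀ e ∈ G, e ∈ F ∨ ∃ x, P x ∧ e ∈ next x) →
      (∀ x, P x → IsPartialElementary L (next x)) → IsPartialElementary L G := by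
    intro P G hG hP
    refine isPartialElementary_of_finset fun s hs => ?_
    have : (s : Set (U × U)) ⊆ F ∨ ∃ x, P x ∧ (s : Set (U × U)) ⊆ next x := by
      induction s using Finset.induction_on with
      | empty => simp
      | insert e s _ ih =>
        rw [Finset.coe_insert, Set.insert_subset_iff] at hs
        rw [Finset.coe_insert]
        rcases ih hs.2 with ih | ⟨x, hx, ih⟩ <;> rcases hG e hs.1 with he | ⟨y, hy, he⟩
        · exact Or.inl (Set.insert_subset he ih)
        · exact Or.inr ⟨y, hy, Set.insert_subset he (ih.trans (Set.subset_union_left.trans (hstage y)))⟩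
        · exact Or.inr ⟨x, hx, Set.insert_subset (hstage x (Or.inl he)) ih⟩
        · rcases trichotomous_of r x y with hxy | rfl | hxy
          · exact Or.inr ⟨y, hy, Set.insert_subset he (ih.trans ((hmono _ _ hxy).trans (hstage y)))⟩
          · exact Or.inr ⟨x, hx, Set.insert_subset he ih⟩
          · exact Or.inr ⟨x, hx, Set.insert_subset (hstage x (hmono _ _ hxy he)) ih⟩
    rcases this with hs | ⟨x, hx, hs⟩
    · exact h.mono hs
    · exact (hP x hx).mono hs
  have hnext : ∀ x, IsPartialElementary L (next x) := by
    intro x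
    induction x using wo.wf.induction with
    | _ x ih =>
      have : IsPartialElementary L (stage x) := by
        refine hfin (fun y => r y x) _ ?_ ih
        rintro e (he | ⟨y, hy, rfl | rfl⟩)
        · exact Or.inl he
        · exact Or.inr ⟨y, hy, Or.inl rfl⟩
        · exact Or.inr ⟨y, hy, Or.inr (Or.inl rfl)⟩
      have := hq (stage x) x this (hcard x)
      rwa [← hp] at this
  refine ⟨F ∪ ⋃ x, next x, Set.subset_union_left, ?_, fun x => ⟨(p x).2, ?_⟩,
    fun y => ⟨(p y).1, ?_⟩⟩
  · refine hfin (fun _ => True) _ ?_ fun x _ => hnext x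
    rintro e (he | he)
    · exact Or.inl he
    · obtain ⟨x, hx⟩ := Set.mem_iUnion.1 he
      exact Or.inr ⟨x, trivial, hx⟩
  · exact Or.inr (Set.mem_iUnion.2 ⟨x, Or.inr (Or.inl rfl)⟩)
  · exact Or.inr (Set.mem_iUnion.2 ⟨y, Or.inl rfl⟩)

/-- Strong homogeneity of infinite saturated structures. -/
theorem SameType.exists_automorphism (hsat : IsSaturatedModel L U) (hU : ℵ₀ ≤ #U) {ι : Type u'}
    {a b : ι → U} (h : SameType L a b) (hι : Cardinal.lift.{w} #ι < Cardinal.lift.{u'} #U) :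
    ∃ e : U ≃[L] U, ∀ i, e (a i) = b i := by
  obtain ⟨G, hFG, hG, hdom, hran⟩ := h.isPartialElementary_range.exists_total hsat hU (by
    rw [← Cardinal.lift_lt.{w, u'}]
    exact mk_range_le_lift.trans_lt hι)
  obtain ⟨e, he⟩ := SameType.exists_equiv hG
    (fun x => (hdom x).elim fun y hy => ⟨⟨(x, y), hy⟩, rfl⟩)
    (fun y => (hran y).elim fun x hx => ⟨⟨(x, y), hx⟩, rfl⟩)
  exact ⟨e, fun i => he ⟨(a i, b i), hFG ⟨i, rfl⟩⟩⟩

/-! ### Automorphisms and the expansion -/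

/-- An isomorphism carrying `D` to `D'` is an isomorphism of the expansions. -/
theorem realize_expLang_iff {n : ℕ} {D D' : Set (Fin n → U)} (e : U ≃[L] U)
    (he : ∀ x, e ∘ x ∈ D' ↔ x ∈ D) {α : Type*} (φ : (expLang L n).Formula α) (x : α → U) :
    (let _ : (predLang n).Structure U := predStructure D'; φ.Realize (e ∘ x)) ↔
    (let _ : (predLang n).Structure U := predStructure D; φ.Realize x) := by
  let S : (expLang L n).Structure U := @sumStructure L (predLang n) U _ (predStructure D)
  let S' : (expLang L n).Structure U := @sumStructure L (predLang n) U _ (predStructure D')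
  let g : @FirstOrder.Language.Equiv (expLang L n) U U S S' :=
    @FirstOrder.Language.Equiv.mk (expLang L n) U U S S' e.toEquiv
      (by
        rintro k (f | f) y
        · exact e.map_fun f y
        · exact f.elim)
      (by
        rintro k (s | s) y
        · exact e.map_rel s y
        · cases s
          exact he y)
  exact @StrongHomClass.realize_formula (expLang L n) U U S S' α _ _ _ g φ x

theorem holdsIn_iff_of_equiv {n : ℕ} {D D' : Set (Fin n → U)} (e : U ≃[L] U)
    (he : ∀ x, e ∘ x ∈ D' ↔ x ∈ D) (φ : (expLang L n).Sentence) : HoldsIn D' φ ↔ HoldsIn D φ := by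
  have := realize_expLang_iff e he φ default
  rwa [Unique.eq_default (e ∘ default)] at this

/-- An automorphism that fixes the parameters and preserves `D` preserves the sets definable from
`D`. -/
theorem comp_mem_solutionSet_iff {n m : ℕ} {A : Set U} {D : Set (Fin n → U)} (e : U ≃[L] U)
    (heA : e ∈ autOver L A) (he : ∀ x, e ∘ x ∈ D ↔ x ∈ D)
    (φ : (expLang L n)[[A]].Formula (Fin m)) (x : Fin m → U) :
    e ∘ x ∈ solutionSet D φ ↔ x ∈ solutionSet D φ := by
  have key := realize_expLang_iff e he (BoundedFormula.constantsVarsEquiv φ)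
    (Sum.elim (fun a : A => (a : U)) x)
  rw [Sum.comp_elim, show e ∘ (fun a : A => (a : U)) = fun a : A => (a : U) from
    funext fun a => heA a a.2] at key
  let _ : (predLang n).Structure U := predStructure D
  have h1 := fun y : Fin m → U => BoundedFormula.realize_constantsVarsEquiv (M := U)
    (φ := φ) (v := y) (xs := default)
  exact (h1 _).symm.trans (key.trans (h1 _))

theorem IsInvariant.comp_mem_iff {n : ℕ} {A : Set U} {D : Set (Fin n → U)}
    (h : IsInvariant L A D) {e : U ≃[L] U} (he : e ∈ autOver L A) (x : Fin n → U) :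
    e ∘ x ∈ D ↔ x ∈ D := by
  have h1 : (fun x => e ∘ x) '' D = D := by
    have : (fun x => e ∘ x) '' D ∈ setOrbit L A D := ⟨e, he, rfl⟩
    rw [h] at this
    exact this
  conv_lhs => rw [← h1]
  exact (e.injective.comp_left).mem_set_image

/-! ### Counting types, small models -/

/-- Pigeonhole: there are fewer than `#U` formulas over `c`, so, `#U` being a strong limit, fewer
than `#U` sets of them. An infinite fibre is all that is needed. -/
theorem exists_infinite_sameType_subset (hκ : (#U).IsInaccessible)
    (hL : Cardinal.lift.{w} L.card < Cardinal.lift.{max u v} #U) {ι : Type w} (hι : #ι < #U)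
    {m : ℕ} (c : ι → U) (K : Set (Fin m → U)) (hK : #K = #U) :
    ∃ T ⊆ K, T.Infinite ∧ ∀ x ∈ T, ∀ y ∈ T, SameType L (Sum.elim c x) (Sum.elim c y) := by
  have hU := hκ.aleph0_lt.le
  have hcard : Cardinal.lift.{w} #(L.Formula (ι ⊕ Fin m)) < Cardinal.lift.{max u v} #U := by
    have h1 : #(L.Formula (ι ⊕ Fin m)) ≤ _ :=
      (mk_le_of_injective (sigma_mk_injective (i := 0))).trans
        (BoundedFormula.card_le (L := L) (α := ι ⊕ Fin m))
    have h2 := Cardinal.lift_le.{w}.2 h1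
    refine h2.trans_lt ?_
    have hU' : ℵ₀ ≤ Cardinal.lift.{max u v} #U := aleph0_le_lift.2 hU
    simp only [lift_max, lift_aleph0, lift_add, lift_lift, mk_sum, mk_fin, lift_natCast]
    refine max_lt (aleph0_lt_lift.2 hκ.aleph0_lt) (add_lt_of_lt hU' (add_lt_of_lt hU' ?_ ?_) ?_)
    · exact (congrFun Cardinal.lift_umax.{w, max u v} #ι).trans_lt (Cardinal.lift_lt.2 hι)
    · exact natCast_lt_aleph0.trans_le hU'
    · exact hL
  -- The strong limit property applies only within the universe of `U`, so the number of formulas is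
  -- first brought down to it.
  obtain ⟨c', hc'⟩ := mem_range_lift_of_le hcard.le
  have hc'U : c' < #U := by rwa [← Cardinal.lift_lt.{w, max u v}, hc']
  have hpow : Cardinal.lift.{w} #(Set (L.Formula (ι ⊕ Fin m))) < Cardinal.lift.{max u v} #K := by
    rw [mk_set, lift_two_power, ← hc', ← lift_two_power, hK, Cardinal.lift_lt]
    exact hκ.isStrongPrelimit hc'U
  have : Infinite K := by rw [infinite_iff, hK]; exact hU
  obtain ⟨t, ht⟩ := exists_infinite_fiber
    (fun x : ULift.{max u v} K => (ULift.up {φ : L.Formula (ι ⊕ Fin m) |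
      φ.Realize (Sum.elim c x.down.1)} : ULift.{w} (Set (L.Formula (ι ⊕ Fin m))))) (by
      rw [mk_uLift, mk_uLift]
      exact hpow)
  refine ⟨{x | ∃ hx : x ∈ K, {φ : L.Formula (ι ⊕ Fin m) | φ.Realize (Sum.elim c x)} = t.down},
    fun x hx => hx.1, ?_, ?_⟩
  · refine ((Set.infinite_coe_iff.1 ht).image
      (Subtype.val_injective.comp ULift.down_injective).injOn).mono ?_
    rintro _ ⟨x, rfl, rfl⟩
    exact ⟨x.down.2, rfl⟩
  · rintro x ⟨-, hx⟩ y ⟨-, hy⟩ φ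
    exact Set.ext_iff.1 (hx.trans hy.symm) φ

theorem exists_small_elementarySubstructure (hκ : (#U).IsInaccessible)
    (hL : Cardinal.lift.{w} L.card < Cardinal.lift.{max u v} #U) {A : Set U} (hA : #A < #U) :
    ∃ M : L.ElementarySubstructure U, A ⊆ (M : Set U) ∧ #M < #U := by
  obtain ⟨c, hc⟩ := mem_range_lift_of_le hL.le
  have hcU : c < #U := by rwa [← Cardinal.lift_lt.{w, max u v}, hc]
  have hmax : max (max ℵ₀ #A) c < #U := max_lt (max_lt hκ.aleph0_lt hA) hcU
  obtain ⟨M, hAM, hM⟩ := exists_elementarySubstructure_card_eq L A (max (max ℵ₀ #A) c)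
    ((le_max_left _ _).trans (le_max_left _ _))
    (Cardinal.lift_le.2 ((le_max_right _ _).trans (le_max_left _ _)))
    (hc.symm.le.trans (Cardinal.lift_le.2 (le_max_right _ _)))
    (Cardinal.lift_le.2 hmax.le)
  refine ⟨M, hAM, ?_⟩
  rw [lift_inj.1 hM]
  exact hmax

/-- Elementarity travels along `M ≅ f[M]` and then along `f` itself. This supplies the conjugated
model at which Lascar invariance is used. -/
theorem exists_elementarySubstructure_image (M : L.ElementarySubstructure U) (f : U ≃[L] U) :
    ∃ N : L.ElementarySubstructure U, (N : Set U) = f '' M := by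
  let i := f.toEmbedding.substructureEquivMap (M : L.Substructure U)
  refine ⟨⟨(M : L.Substructure U).map f.toEmbedding.toHom, fun k φ x => ?_⟩, rfl⟩
  obtain ⟨y, rfl⟩ : ∃ y : Fin k → (M : L.Substructure U), x = i ∘ y :=
    ⟨i.symm ∘ x, funext fun j => (i.apply_symm_apply (x j)).symm⟩
  rw [StrongHomClass.realize_formula i, ← M.isElementary φ y, ← StrongHomClass.realize_formula f (v := _ ∘ y)]
  rfl

end LascarPseudo

/-! ### The proposition -/

open LascarPseudo in
theorem mainTheorem8 (L : FirstOrder.Language.{u, v}) (U : Type w) [L.Structure U]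
    (hsat : LascarPseudo.IsSaturatedModel L U)
    (hκ : (#U).IsInaccessible)
    (hL : Cardinal.lift.{w} L.card < Cardinal.lift.{max u v} #U)
    (n : ℕ) (D : Set (Fin n → U)) (A : Set U) (hA : #A < #U)
    (hD : LascarPseudo.IsLascarInvariant L A D)
    (m : ℕ) (φ : (LascarPseudo.expLang L n)[[A]].Formula (Fin m)) :
    LascarPseudo.IsPseudoInvariant L A (LascarPseudo.solutionSet D φ) := by
  intro b hb K hKb hK k
  have hU := hκ.aleph0_lt.le
  obtain ⟨M, hAM, hM⟩ := exists_small_elementarySubstructure hκ hL hA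
  obtain ⟨T, hTK, hT, hTM⟩ :=
    exists_infinite_sameType_subset (L := L) hκ hL hM (fun a : M => (a : U)) K hK
  obtain ⟨x₀, hx₀⟩ := hT.nonempty
  obtain ⟨f, hfA, rfl⟩ := hKb (hTK hx₀)
  let C : Set (Fin m → U) := {x | f.symm ∘ x ∈ solutionSet D φ}
  have hfC : ∀ x, f ∘ x ∈ C ↔ x ∈ solutionSet D φ := fun x => by
    have : f.symm ∘ f ∘ x = x := funext fun i => f.symm_apply_apply (x i)
    simp only [C, Set.mem_ofPred_eq, this]
  refine ⟨C, holdsIn_iff_of_equiv f hfC, ?_⟩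
  have hTC : T ⊆ K ∩ C := by
    intro x hx
    refine ⟨hTK hx, ?_⟩
    obtain ⟨g, hg⟩ := (hTM _ hx₀ _ hx).exists_automorphism hsat hU (by
      rw [mk_sum, lift_add, lift_lift, lift_lift, mk_fin, Cardinal.lift_natCast]
      simpa using add_lt_of_lt hU hM (hκ.nat_lt m))
    have hgM : ∀ a ∈ M, g a = a := fun a ha => hg (Sum.inl ⟨a, ha⟩)
    have hgx : g ∘ f ∘ b = x := funext fun i => hg (Sum.inr i)
    -- The conjugate of `g` by `f` fixes the elementary substructure `f⁻¹[M]`.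
    let e : U ≃[L] U := f.symm.comp (g.comp f)
    obtain ⟨N, hN⟩ := exists_elementarySubstructure_image M f.symm
    have hAN : A ⊆ (N : Set U) := fun a ha => by
      rw [hN]
      -- `f` fixes `A` pointwise, so `A` survives in the conjugated model.
      exact ⟨a, hAM ha, by conv_lhs => rw [← hfA a ha, f.symm_apply_apply]⟩
    have hNU : #N < #U := by
      have : #(N : Set U) < #U := by
        rw [hN]
        exact mk_image_le.trans_lt hM
      exact this
    have heN : e ∈ autOver L (N : Set U) := fun a ha => by
      rw [hN] at ha
      obtain ⟨c, hc, rfl⟩ := ha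
      change f.symm (g (f (f.symm c))) = f.symm c
      rw [f.apply_symm_apply, hgM c hc]
    have hex : e ∘ b = f.symm ∘ x := by rw [← hgx]; rfl
    change f.symm ∘ x ∈ solutionSet D φ
    rw [← hex, comp_mem_solutionSet_iff e (fun a ha => heN a (hAN ha))
      ((hD N hAN hNU).comp_mem_iff heN)]
    exact hb
  rw [(hT.mono hTC).encard_eq]
  exact le_top
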